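/- **Theorem 2.** Let $(X_t)_{t\ge 0}$ be a bilateral birth-and-death process on $\mathbb Z$ with birth rates $\lambda_n>0$ and death rates $\mu_n>0$ ($n\in\mathbb Z$). That is, $X$ is a time-homogeneous Markov process, whose paths are right-continuous step functions with left limits in $\mathbb Z$ up to a possible explosion time (after which $X$ stays in a cemetery state), such that as $\delta\downarrow 0$ a process started at $n$ is at time $\delta$ in $n+1$ with probability $\lambda_n\delta+o(\delta)$, in $n-1$ with probability $\mu_n\delta+o(\delta)$, and in $n$ with probability $1-(\lambda_n+\mu_n)\delta+o(\delta)$. Let $(\nu_n)_{n\in\mathbb Z}$ be a strictly monotonic sequence of positive numbers with $$\nu_{n+1}\lambda_n-\nu_n(\lambda_n+\mu_n)+\nu_{n-1}\mu_n=0\qquad(n\in\mathbb Z),$$ and let $\widetilde X_t$ be a bilateral birth-and-death process (in the same sense) with rates $$\widetilde\lambda_n=\lambda_n\frac{\nu_{n+1}}{\nu_n},\qquad \widetilde\mu_n=\mu_n\frac{\nu_{n-1}}{\nu_n}\qquad(n\in\mathbb Z).$$ For $k\ne s$ and $t>0$ let $$g_{k,s}(t)=\frac{d}{dt}\Pr\bigl(\inf\{u>0: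 X_u=s\}<t\,\big|\,X_0=k\bigr)$$ be the first-passage-time density of $X$ from $k$ to $s$, let $\mathcal P_{k,s}=\int_0^\infty g_{k,s}(t)\,dt$ be the ultimate crossing probability, and let $\widetilde g_{k,s}$, $\widetilde{\mathcal P}_{k,s}$ be the corresponding quantities for $\widetilde X$. Then, for all $k\neq s$, these (possibly defective) densities exist: both distribution functions are differentiable at every $t>0$ and are the integrals over $(0,t)$ of their derivatives, which are integrable on $(0,\infty)$. Moreover, $$\widetilde g_{k,s}(t)=\frac{\nu_s}{\nu_k}\,g_{k,s}(t)\quad(t>0),\qquad \widetilde{\mathcal P}_{k,s}=\frac{\nu_s}{\nu_k}\,\mathcal P_{k,s},\qquad \widetilde{\mathcal P}_{k,s}\neq\mathcal P_{k,s}.$$ -/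

import Mathlib

open MeasureTheory Filter Topology Set
open scoped NNReal ENNReal

/-- `X`, under the family of laws `P k` (`k` the initial state), is a bilateral birth-and-death
process with birth rates `lam n` and death rates `mu n`.

States are integers; the extra value `none` is a cemetery, which is entered only if the process
explodes (i.e. makes infinitely many jumps in finite time). Processes that never explode are those
that never take the value `none`; non-explosion is not required. Up to explosion the paths are
right-continuous step functions with left limits in `ℤ`, so that the rates determine the law. -/
structure IsBilateralBirthDeath (lam mu : ℤ → ℝ) {Ω : Type*} [MeasurableSpace Ω]
    (P : ℤ → Measure Ω) (X : ℝ≥0 → Ω → Option ℤ) : Prop where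
  birth_pos : ∀ n, 0 < lam n
  death_pos : ∀ n, 0 < mu n
  isProbabilityMeasure : ∀ k, IsProbabilityMeasure (P k)
  measurableSet_eq : ∀ t (n : ℤ), MeasurableSet {ω | X t ω = some n}
  initial : ∀ k, ∀ᵐ ω ∂P k, X 0 ω = some k
  /-- Paths are right-continuous (`ℤ` being discrete) at every time before explosion. -/
  right_continuous : ∀ k, ∀ᵐ ω ∂P k, ∀ t (n : ℤ), X t ω = some n →
    ∀ᶠ u in 𝓝[>] t, X u ω = some n
  /-- Paths have left limits in `ℤ` at every time before explosion. -/
  left_limit : ∀ k, ∀ᵐ ω ∂P k, ∀ t (n : ℤ), X t ω = some n →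
    ∃ m : ℤ, ∀ᶠ u in 𝓝[<] t, X u ω = some m
  /-- The cemetery is absorbing. -/
  absorbing : ∀ k, ∀ᵐ ω ∂P k, ∀ t u, t ≤ u → X t ω = none → X u ω = none
  /-- The (time-homogeneous) Markov property with respect to the past `σ(X r, r ≤ t)`. -/
  markov : ∀ (k : ℤ) (t u : ℝ≥0) (i j : ℤ) (A : Set Ω),
    MeasurableSet[⨆ r : Set.Iic t, (⊤ : MeasurableSpace (Option ℤ)).comap (X r)] A →
    P k (A ∩ {ω | X t ω = some i} ∩ {ω | X (t + u) ω = some j}) =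
      P k (A ∩ {ω | X t ω = some i}) * P i {ω | X u ω = some j}
  birth_rate : ∀ n : ℤ, Tendsto (fun δ : ℝ≥0 => (P n).real {ω | X δ ω = some (n + 1)} / (δ : ℝ))
    (𝓝[>] 0) (𝓝 (lam n))
  death_rate : ∀ n : ℤ, Tendsto (fun δ : ℝ≥0 => (P n).real {ω | X δ ω = some (n - 1)} / (δ : ℝ))
    (𝓝[>] 0) (𝓝 (mu n))
  /-- Together with the two limits above: all other transitions have probability `o(δ)`. -/
  leave_rate : ∀ n : ℤ, Tendsto (fun δ : ℝ≥0 => (1 - (P n).real {ω | X δ ω = some n}) / (δ : ℝ))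
    (𝓝[>] 0) (𝓝 (lam n + mu n))

noncomputable section

/-- The first-passage time `inf {t > 0 : X t = s}`, equal to `∞` if `s` is never visited. -/
def firstPassageTime {Ω : Type*} (X : ℝ≥0 → Ω → Option ℤ) (s : ℤ) (ω : Ω) : ℝ≥0∞ :=
  ⨅ (t : ℝ≥0) (_ : 0 < t ∧ X t ω = some s), (t : ℝ≥0∞)

/-- `t ↦ Pr (inf {u > 0 : X u = s} < t | X 0 = k)`. -/
def firstPassageCDF {Ω : Type*} [MeasurableSpace Ω] (P : ℤ → Measure Ω)
    (X : ℝ≥0 → Ω → Option ℤ) (k s : ℤ) (t : ℝ) : ℝ :=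
  (P k).real {ω | firstPassageTime X s ω < ENNReal.ofReal t}

/-- The first-passage-time density `g k s t`, the derivative of `firstPassageCDF`. -/
def firstPassageDensity {Ω : Type*} [MeasurableSpace Ω] (P : ℤ → Measure Ω)
    (X : ℝ≥0 → Ω → Option ℤ) (k s : ℤ) (t : ℝ) : ℝ :=
  deriv (firstPassageCDF P X k s) t

/-- The first-passage time from `k` to `s` has `firstPassageDensity` as a genuine
(possibly defective) density. -/
def HasFirstPassageDensity {Ω : Type*} [MeasurableSpace Ω] (P : ℤ → Measure Ω)
    (X : ℝ≥0 → Ω → Option ℤ) (k s : ℤ) : Prop :=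
  (∀ t : ℝ, 0 < t → DifferentiableAt ℝ (firstPassageCDF P X k s) t) ∧
  IntegrableOn (firstPassageDensity P X k s) (Ioi 0) ∧
  ∀ t : ℝ, 0 ≤ t → firstPassageCDF P X k s t = ∫ u in (0 : ℝ)..t, firstPassageDensity P X k s u

/-- The ultimate crossing probability, `∫₀^∞ g k s t dt`. -/
def crossingProbability {Ω : Type*} [MeasurableSpace Ω] (P : ℤ → Measure Ω)
    (X : ℝ≥0 → Ω → Option ℤ) (k s : ℤ) : ℝ :=
  ∫ t in Ioi (0 : ℝ), firstPassageDensity P X k s t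

end

/-!
Kill the chain outside a finite set `K` of states. The probability of absorption at `s` by time `t`
without leaving `K` is an entry of the exponential of `t` times the killed generator, because that
exponential is the limit of powers of the transition matrix of the discrete skeleton. As `K`
exhausts `ℤ` these probabilities increase to the first-passage distribution function, which is
therefore determined by the rates even if the process explodes.

The hypothesis on `ν` says that the killed generator with the transformed rates is the conjugate of
the original one by `diag ν`, so the first-passage distribution functions have ratio `ν s / ν k`.
The integrated backward equation supplies the densities and the strict positivity of the crossing
probability, and a strictly monotone `ν` takes different values at `s` and `k`.
-/

section PowExp

variable {𝔸 : Type*} [NormedRing 𝔸]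

theorem norm_pow_sub_pow_le {x y : 𝔸} {M : ℝ} (hx : ‖x‖ ≤ M) (hy : ‖y‖ ≤ M) (n : ℕ) :
    ‖x ^ n - y ^ n‖ ≤ n * M ^ (n - 1) * ‖x - y‖ := by
  have hM : 0 ≤ M := (norm_nonneg x).trans hx
  induction n with
  | zero => simp
  | succ n ih =>
    rcases n.eq_zero_or_pos with rfl | hn
    · simp
    calc ‖x ^ (n + 1) - y ^ (n + 1)‖
        = ‖x ^ n * (x - y) + (x ^ n - y ^ n) * y‖ := by
          rw [pow_succ, pow_succ]; congr 1; noncomm_ring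
      _ ≤ ‖x ^ n‖ * ‖x - y‖ + ‖x ^ n - y ^ n‖ * ‖y‖ :=
          (norm_add_le _ _).trans (add_le_add (norm_mul_le _ _) (norm_mul_le _ _))
      _ ≤ M ^ n * ‖x - y‖ + n * M ^ (n - 1) * ‖x - y‖ * M := by
          gcongr
          exact (norm_pow_le' x hn).trans (by gcongr)
      _ = (n + 1 : ℕ) * M ^ (n + 1 - 1) * ‖x - y‖ := by
          rw [n.add_sub_cancel, Nat.cast_succ, ← mul_pow_sub_one hn.ne' M]
          ring

variable [NormedAlgebra ℝ 𝔸] {A C : ℕ → 𝔸} {B : 𝔸}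

theorem eventually_norm_le_exp_div [NormOneClass 𝔸]
    (hA : Tendsto (fun n : ℕ => (n : ℝ) • (A n - 1)) atTop (𝓝 B)) :
    ∀ᶠ n : ℕ in atTop, ‖A n‖ ≤ Real.exp ((‖B‖ + 1) / n) := by
  filter_upwards [hA.norm.eventually (ge_mem_nhds (lt_add_one ‖B‖)), eventually_gt_atTop 0]
    with n hn hn0
  have hn0' : (0 : ℝ) < n := Nat.cast_pos.2 hn0
  calc ‖A n‖ ≤ ‖A n - 1‖ + ‖(1 : 𝔸)‖ := norm_le_norm_sub_add _ _
    _ ≤ (‖B‖ + 1) / n + 1 := by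
        rw [norm_one]
        gcongr
        rw [le_div_iff₀' hn0']
        rwa [norm_smul, Real.norm_natCast] at hn
    _ ≤ Real.exp ((‖B‖ + 1) / n) := Real.add_one_le_exp _

theorem tendsto_pow_sub_pow_of_tendsto_smul_sub_one [NormOneClass 𝔸]
    (hA : Tendsto (fun n : ℕ => (n : ℝ) • (A n - 1)) atTop (𝓝 B))
    (hC : Tendsto (fun n : ℕ => (n : ℝ) • (C n - 1)) atTop (𝓝 B)) :
    Tendsto (fun n => A n ^ n - C n ^ n) atTop (𝓝 0) := by
  have hdiff : Tendsto (fun n : ℕ => Real.exp (‖B‖ + 1) *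
      ‖(n : ℝ) • (A n - 1) - (n : ℝ) • (C n - 1)‖) atTop (𝓝 0) := by
    simpa only [sub_self, norm_zero, mul_zero] using
      (hA.sub hC).norm.const_mul (Real.exp (‖B‖ + 1))
  refine squeeze_zero_norm' ?_ hdiff
  filter_upwards [eventually_norm_le_exp_div hA, eventually_norm_le_exp_div hC,
    eventually_gt_atTop 0] with n hAn hCn hn
  set M := Real.exp ((‖B‖ + 1) / n)
  have hMpow : M ^ n = Real.exp (‖B‖ + 1) := by
    rw [← Real.exp_nat_mul, mul_div_cancel₀ _ (Nat.cast_ne_zero.2 hn.ne')]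
  have hM : 1 ≤ M := Real.one_le_exp (by positivity)
  calc ‖A n ^ n - C n ^ n‖ ≤ n * M ^ (n - 1) * ‖A n - C n‖ := norm_pow_sub_pow_le hAn hCn n
    _ ≤ n * M ^ n * ‖A n - C n‖ := by
        gcongr
        exact n.sub_le 1
    _ = Real.exp (‖B‖ + 1) * ‖(n : ℝ) • (A n - 1) - (n : ℝ) • (C n - 1)‖ := by
        rw [hMpow, ← smul_sub, sub_sub_sub_cancel_right, norm_smul, Real.norm_natCast]
        ring

theorem tendsto_smul_exp_inv_smul_sub_one [CompleteSpace 𝔸] (B : 𝔸) :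
    Tendsto (fun n : ℕ => (n : ℝ) • (NormedSpace.exp ((n : ℝ)⁻¹ • B) - 1)) atTop (𝓝 B) := by
  have hslope := (hasDerivAt_exp_smul_const (𝕂 := ℝ) B 0).tendsto_slope
  simp only [zero_smul, NormedSpace.exp_zero, one_mul] at hslope
  have hinv : Tendsto (fun n : ℕ => (n : ℝ)⁻¹) atTop (𝓝[≠] 0) :=
    (tendsto_inv_atTop_nhdsGT_zero.comp tendsto_natCast_atTop_atTop).mono_right
      (nhdsWithin_mono _ fun _ h => ne_of_gt h)
  refine (hslope.comp hinv).congr fun n => ?_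
  simp [slope]

theorem tendsto_pow_exp_of_tendsto_smul_sub_one [NormOneClass 𝔸] [CompleteSpace 𝔸]
    (hA : Tendsto (fun n : ℕ => (n : ℝ) • (A n - 1)) atTop (𝓝 B)) :
    Tendsto (fun n => A n ^ n) atTop (𝓝 (NormedSpace.exp B)) := by
  have hdiff := tendsto_pow_sub_pow_of_tendsto_smul_sub_one hA
    (tendsto_smul_exp_inv_smul_sub_one B)
  have hpow : Tendsto (fun n : ℕ => NormedSpace.exp ((n : ℝ)⁻¹ • B) ^ n) atTop
      (𝓝 (NormedSpace.exp B)) := by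
    let _ : NormedAlgebra ℚ 𝔸 := NormedAlgebra.restrictScalars ℚ ℝ 𝔸
    refine tendsto_const_nhds.congr' ?_
    filter_upwards [eventually_ne_atTop 0] with n hn
    rw [← NormedSpace.exp_nsmul, ← Nat.cast_smul_eq_nsmul ℝ,
      smul_inv_smul₀ (Nat.cast_ne_zero.2 hn)]
  simpa using hdiff.add hpow

end PowExp

section FirstExit

variable {ι β : Type*} {D : Set β} {a b : β}

/-- `x` is at `a` at time `u` and in `D` at all earlier times. For `a ∉ D` this says that `u` is the
first exit time from `D` and `a` the exit position. -/
def ReachesThrough [LT ι] (x : ι → β) (D : Set β) (a : β) (u : ι) : Prop :=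
  x u = a ∧ ∀ v < u, x v ∈ D

namespace ReachesThrough

theorem mono [LT ι] {x : ι → β} {D' : Set β} {u : ι} (h : ReachesThrough x D a u) (hD : D ⊆ D') :
    ReachesThrough x D' a u :=
  ⟨h.1, fun v hv => hD (h.2 v hv)⟩

theorem exit_unique [LinearOrder ι] {x : ι → β} {i j : ι} (hi : ReachesThrough x D a i)
    (ha : a ∉ D) (hj : ReachesThrough x D b j) (hb : b ∉ D) : i = j ∧ a = b := by
  obtain rfl : i = j := by
    rcases lt_trichotomy i j with hij | hij | hij
    · exact absurd (hi.1 ▸ hj.2 i hij) ha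
    · exact hij
    · exact absurd (hj.1 ▸ hi.2 j hij) hb
  exact ⟨rfl, hi.1.symm.trans hj.1⟩

end ReachesThrough

open Classical in
/-- The sequence `z` frozen at the position where it first leaves `D`. -/
noncomputable def stoppedAtExit (z : ℕ → β) (D : Set β) : ℕ → β
  | 0 => z 0
  | n + 1 => if stoppedAtExit z D n ∈ D then z (n + 1) else stoppedAtExit z D n

theorem exists_reachesThrough_stoppedAtExit (z : ℕ → β) (D : Set β) (n : ℕ) :
    ∃ i ≤ n, ReachesThrough z D (stoppedAtExit z D n) i ∧ (i = n ∨ stoppedAtExit z D n ∉ D) := by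
  induction n with
  | zero => exact ⟨0, le_rfl, ⟨rfl, by simp⟩, Or.inl rfl⟩
  | succ n ih =>
    obtain ⟨i, hin, hi, hlast⟩ := ih
    by_cases hD : stoppedAtExit z D n ∈ D
    · obtain rfl : i = n := hlast.resolve_right (not_not.2 hD)
      refine ⟨i + 1, le_rfl, ⟨(if_pos hD).symm, fun l hl => ?_⟩, Or.inl rfl⟩
      rcases (Nat.lt_succ_iff.1 hl).lt_or_eq with hl | rfl
      · exact hi.2 l hl
      · exact hi.1 ▸ hD
    · have hfrozen : stoppedAtExit z D (n + 1) = stoppedAtExit z D n := if_neg hD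
      rw [hfrozen]
      exact ⟨i, hin.trans n.le_succ, hi, Or.inr hD⟩

theorem stoppedAtExit_eq_of_mem {z : ℕ → β} {n : ℕ} (h : stoppedAtExit z D n ∈ D) :
    stoppedAtExit z D n = z n := by
  obtain ⟨i, -, hi, hlast⟩ := exists_reachesThrough_stoppedAtExit z D n
  obtain rfl : i = n := hlast.resolve_right (not_not.2 h)
  exact hi.1.symm

theorem stoppedAtExit_eq_iff {z : ℕ → β} (ha : a ∉ D) {n : ℕ} :
    stoppedAtExit z D n = a ↔ ∃ i ≤ n, ReachesThrough z D a i := by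
  obtain ⟨i, hin, hi, hlast⟩ := exists_reachesThrough_stoppedAtExit z D n
  refine ⟨fun h => ⟨i, hin, h ▸ hi⟩, ?_⟩
  rintro ⟨j, hjn, hj⟩
  by_cases hD : stoppedAtExit z D n ∈ D
  · have hzn : z n ∈ D := stoppedAtExit_eq_of_mem hD ▸ hD
    rcases hjn.lt_or_eq with hjn | rfl
    · obtain rfl : i = n := hlast.resolve_right (not_not.2 hD)
      exact absurd (hj.1 ▸ hi.2 j hjn) ha
    · exact absurd (hj.1 ▸ hzn) ha
  · exact (hi.exit_unique hD hj ha).2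

theorem exists_reachesThrough_of_notMem {x : ℝ≥0 → β}
    (hx : ∀ u, ∀ᶠ v in 𝓝[>] u, x v = x u) {u : ℝ≥0} (hu : x u ∉ D) :
    ∃ T ≤ u, x T ∉ D ∧ ReachesThrough x D (x T) T := by
  have hne : {v | x v ∉ D}.Nonempty := ⟨u, hu⟩
  set T := sInf {v | x v ∉ D}
  have hTle : ∀ v, x v ∉ D → T ≤ v := fun v hv => csInf_le (OrderBot.bddBelow _) hv
  refine ⟨T, hTle u hu, fun hTD => ?_, rfl, fun v hv => by_contra fun h => (hTle v h).not_gt hv⟩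
  obtain ⟨w, hTw, hw⟩ := mem_nhdsGT_iff_exists_Ioo_subset.1 (hx T)
  obtain ⟨v, hv, hvw⟩ := exists_lt_of_csInf_lt hne hTw
  rcases (hTle v hv).eq_or_lt with hTv | hTv
  · exact hv (hTv ▸ hTD)
  · exact hv ((hw ⟨hTv, hvw⟩ : x v = x T) ▸ hTD)

theorem tendsto_div_natCast_add_one_nhdsGT {t : ℝ≥0} (ht : 0 < t) :
    Tendsto (fun n : ℕ => t / ((n : ℝ≥0) + 1)) atTop (𝓝[>] 0) := by
  refine tendsto_nhdsWithin_iff.2 ⟨?_, Eventually.of_forall fun n => by rw [mem_Ioi]; positivity⟩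
  rw [← NNReal.tendsto_coe]
  push_cast
  exact tendsto_const_nhds.div_atTop
    (tendsto_atTop_add_const_right _ _ tendsto_natCast_atTop_atTop)

theorem natCast_mul_div_add_one_lt {t : ℝ≥0} (ht : 0 < t) {i n : ℕ} (hi : i ≤ n) :
    i * (t / (n + 1)) < t := by
  rw [mul_div_assoc', div_lt_iff₀ (by positivity), mul_comm]
  gcongr
  exact_mod_cast Nat.lt_succ_iff.2 hi

theorem eventually_exists_mul_mem_Ico {t u w : ℝ≥0} (huw : u < w) (hwt : w ≤ t) :
    ∀ᶠ n : ℕ in atTop, ∃ i ≤ n, i * (t / (n + 1)) ∈ Ico u w ∧ ∀ l < i, l * (t / (n + 1)) < u := by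
  have ht : 0 < t := pos_of_gt (huw.trans_le hwt)
  have hmesh : Tendsto (fun n : ℕ => u + t / ((n : ℝ≥0) + 1)) atTop (𝓝 (u + 0)) :=
    tendsto_const_nhds.add ((tendsto_div_natCast_add_one_nhdsGT ht).mono_right nhdsWithin_le_nhds)
  filter_upwards [hmesh.eventually (gt_mem_nhds ((add_zero u).symm ▸ huw))] with n hn
  set δ : ℝ≥0 := t / (n + 1) with hδ
  have hδpos : 0 < δ := by positivity
  have hlt : (⌈u / δ⌉₊ : ℝ≥0) * δ < w := by
    calc (⌈u / δ⌉₊ : ℝ≥0) * δ < (u / δ + 1) * δ := by gcongr; exact Nat.ceil_lt_add_one zero_le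
      _ = u + δ := by field_simp
      _ < w := hn
  refine ⟨⌈u / δ⌉₊, ?_, ⟨(div_le_iff₀ hδpos).1 (Nat.le_ceil _), hlt⟩,
    fun l hl => (lt_div_iff₀ hδpos).1 (Nat.lt_ceil.1 hl)⟩
  have hlt' : (⌈u / δ⌉₊ : ℝ≥0) * δ < ((n + 1 : ℕ) : ℝ≥0) * δ :=
    (hlt.trans_le hwt).trans_eq (by rw [hδ]; push_cast; field_simp)
  exact Nat.lt_succ_iff.1 (Nat.cast_lt.1 (lt_of_mul_lt_mul_right hlt' hδpos.le))

theorem eventually_sampled_reachesThrough_iff {x : ℝ≥0 → β}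
    (hx : ∀ u, ∀ᶠ v in 𝓝[>] u, x v = x u) (ha : a ∉ D) {t : ℝ≥0} (ht : 0 < t) :
    ∀ᶠ n : ℕ in atTop, (∃ i ≤ n, ReachesThrough (fun l : ℕ => x (l * (t / (n + 1)))) D a i) ↔
      ∃ u < t, ReachesThrough x D a u := by
  by_cases hstay : ∀ u < t, x u ∈ D
  · refine Eventually.of_forall fun n => iff_of_false ?_ ?_
    · rintro ⟨i, hi, hxi, -⟩
      exact ha (hxi ▸ hstay _ (natCast_mul_div_add_one_lt ht hi))
    · rintro ⟨u, hut, hxu, -⟩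
      exact ha (hxu ▸ hstay u hut)
  push Not at hstay
  obtain ⟨u, hut, hu⟩ := hstay
  obtain ⟨T, hTu, hTD, hT⟩ := exists_reachesThrough_of_notMem hx hu
  have hTt : T < t := hTu.trans_lt hut
  have hstay : ∀ᶠ v in 𝓝[≥] T, x v = x T := by
    rw [← Ioi_insert, nhdsWithin_insert, eventually_sup, eventually_pure]
    exact ⟨rfl, hx T⟩
  obtain ⟨w, hTw, hw⟩ := mem_nhdsGE_iff_exists_Ico_subset.1 hstay
  filter_upwards [eventually_exists_mul_mem_Ico (lt_min hTw hTt) (min_le_right w t)] with n hn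
  obtain ⟨i, hin, ⟨hTi, hiw⟩, hl⟩ := hn
  have hfirst : ReachesThrough (fun l : ℕ => x (l * (t / (n + 1)))) D (x T) i :=
    ⟨hw ⟨hTi, hiw.trans_le (min_le_left w t)⟩, fun l hli => hT.2 _ (hl l hli)⟩
  constructor
  · rintro ⟨j, -, hj⟩
    exact ⟨T, hTt, (hfirst.exit_unique hTD hj ha).2 ▸ hT⟩
  · rintro ⟨v, -, hv⟩
    exact ⟨i, hin, (hT.exit_unique hTD hv ha).2 ▸ hfirst⟩

theorem finite_image_of_eventually_eq_nhdsLT_nhdsGT {ι : Type*} [LinearOrder ι]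
    [TopologicalSpace ι] {x : ι → β} {S : Set ι} (hS : IsCompact S)
    (hleft : ∀ u ∈ S, ∃ b, ∀ᶠ v in 𝓝[<] u, x v = b)
    (hright : ∀ u ∈ S, ∃ b, ∀ᶠ v in 𝓝[>] u, x v = b) : (x '' S).Finite := by
  refine hS.induction_on (p := fun S => (x '' S).Finite) (by simp)
    (fun _ _ hST hT => hT.subset (image_mono hST))
    (fun _ _ hS hT => by rw [image_union]; exact hS.union hT) fun u hu => ?_
  obtain ⟨b, hb⟩ := hleft u hu
  obtain ⟨c, hc⟩ := hright u hu
  have hnear : ∀ᶠ v in 𝓝 u, x v ∈ ({b, x u, c} : Set β) := by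
    filter_upwards [eventually_nhdsWithin_iff.1 hb, eventually_nhdsWithin_iff.1 hc] with v hvb hvc
    rcases lt_trichotomy v u with h | rfl | h
    · simp [hvb h]
    · simp
    · simp [hvc h]
  exact ⟨_, mem_nhdsWithin_of_mem_nhds hnear, (toFinite {b, x u, c}).subset (image_subset_iff.2
    fun _ hv => hv)⟩

end FirstExit

section KilledGenerator

open scoped Matrix.Norms.Operator

variable {α : Type*} [DecidableEq α] {Q Q' : α → α → ℝ} {s k : α} {K : Finset α}

/-- The generator of the chain with rates `Q`, absorbed at `s` and killed on leaving the finite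
set `K`. -/
def killedGenerator (Q : α → α → ℝ) (s : α) (K : Finset α) : Matrix K K ℝ :=
  Matrix.of fun i j => if (i : α) = s then 0 else Q i j

/-- The probability that the chain with rates `Q` reaches `s` from `k` by time `t` without leaving
`K`, as an entry of the matrix exponential of the killed generator; it is `0` unless `k, s ∈ K`. -/
noncomputable def absorptionProbability (Q : α → α → ℝ) (s : α) (K : Finset α) (k : α) (t : ℝ) :
    ℝ :=
  if h : k ∈ K ∧ s ∈ K then NormedSpace.exp (t • killedGenerator Q s K) ⟨k, h.1⟩ ⟨s, h.2⟩ else 0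

theorem absorptionProbability_of_mem (hk : k ∈ K) (hs : s ∈ K) (t : ℝ) :
    absorptionProbability Q s K k t =
      NormedSpace.exp (t • killedGenerator Q s K) ⟨k, hk⟩ ⟨s, hs⟩ :=
  dif_pos ⟨hk, hs⟩

theorem absorptionProbability_of_notMem (hk : k ∉ K) (t : ℝ) :
    absorptionProbability Q s K k t = 0 :=
  dif_neg fun h => hk h.1

theorem absorptionProbability_zero (hks : k ≠ s) : absorptionProbability Q s K k 0 = 0 := by
  by_cases h : k ∈ K ∧ s ∈ K
  · rw [absorptionProbability_of_mem h.1 h.2, zero_smul, NormedSpace.exp_zero]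
    exact Matrix.one_apply_ne fun e => hks (congrArg Subtype.val e)
  · exact dif_neg h

theorem hasDerivAt_absorptionProbability (hk : k ∈ K) (hs : s ∈ K) (t : ℝ) :
    HasDerivAt (absorptionProbability Q s K k)
      (if k = s then 0 else ∑ j ∈ K, Q k j * absorptionProbability Q s K j t) t := by
  have hexp := hasDerivAt_exp_smul_const' (𝕂 := ℝ) (killedGenerator Q s K) t
  have hentry := hasDerivAt_pi.1 (hasDerivAt_pi.1 hexp ⟨k, hk⟩) ⟨s, hs⟩
  rw [funext fun u => absorptionProbability_of_mem (Q := Q) hk hs u]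
  refine hentry.congr_deriv ?_
  rw [Matrix.mul_apply]
  split_ifs with hks
  · simp [killedGenerator, hks]
  · rw [← Finset.sum_coe_sort K]
    refine Finset.sum_congr rfl fun j _ => ?_
    rw [absorptionProbability_of_mem j.2 hs]
    exact congrArg (· * _) (if_neg hks)

theorem continuous_absorptionProbability : Continuous (absorptionProbability Q s K k) := by
  by_cases h : k ∈ K ∧ s ∈ K
  · exact continuous_iff_continuousAt.2 fun t =>
      (hasDerivAt_absorptionProbability h.1 h.2 t).continuousAt
  · rw [show absorptionProbability Q s K k = fun _ => 0 from funext fun _ => dif_neg h]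
    exact continuous_const

theorem absorptionProbability_self (hs : s ∈ K) (t : ℝ) : absorptionProbability Q s K s t = 1 := by
  have hderiv (u : ℝ) : HasDerivAt (absorptionProbability Q s K s) 0 u := by
    simpa only [if_true] using hasDerivAt_absorptionProbability (Q := Q) hs hs u
  rw [is_const_of_deriv_eq_zero (fun u => (hderiv u).differentiableAt) (fun u => (hderiv u).deriv)
    t 0, absorptionProbability_of_mem hs hs, zero_smul, NormedSpace.exp_zero, Matrix.one_apply_eq]

theorem absorptionProbability_doobTransform {h : α → ℝ} (hh : ∀ i, h i ≠ 0)
    (hQ : ∀ i j, Q' i j = h j / h i * Q i j) (t : ℝ) :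
    absorptionProbability Q' s K k t = h s / h k * absorptionProbability Q s K k t := by
  by_cases hks : k ∈ K ∧ s ∈ K
  swap
  · simp only [absorptionProbability, dif_neg hks, mul_zero]
  set D : Matrix K K ℝ := Matrix.diagonal fun j => h j with hD
  set D' : Matrix K K ℝ := Matrix.diagonal fun j => (h j)⁻¹ with hD'
  have hDD' : D * D' = 1 := by
    simp only [hD, hD', Matrix.diagonal_mul_diagonal, mul_inv_cancel₀ (hh _), Matrix.diagonal_one]
  have hinv : D⁻¹ = D' := Matrix.inv_eq_right_inv hDD'
  have hconj : t • killedGenerator Q' s K = D⁻¹ * (t • killedGenerator Q s K) * D := by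
    rw [hinv]
    ext i j
    rw [Matrix.mul_diagonal, Matrix.diagonal_mul]
    simp only [killedGenerator, Matrix.smul_apply, Matrix.of_apply, smul_eq_mul, hQ]
    split_ifs
    · ring
    · ring
  rw [absorptionProbability_of_mem hks.1 hks.2, absorptionProbability_of_mem hks.1 hks.2, hconj,
    Matrix.exp_conj' D _ (IsUnit.of_mul_eq_one D' hDD'), hinv, Matrix.mul_diagonal,
    Matrix.diagonal_mul]
  ring

end KilledGenerator

section BirthDeathRate

variable {lam mu : ℤ → ℝ}

/-- The generator of the birth-and-death process with rates `lam`, `mu`, acting on functions. -/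
def birthDeathOperator (lam mu f : ℤ → ℝ) (k : ℤ) : ℝ :=
  lam k * f (k + 1) + mu k * f (k - 1) - (lam k + mu k) * f k

/-- The rate matrix of the birth-and-death process with rates `lam`, `mu`. -/
def birthDeathRate (lam mu : ℤ → ℝ) (i j : ℤ) : ℝ :=
  birthDeathOperator lam mu (Pi.single j 1) i

theorem sum_birthDeathRate_mul {f : ℤ → ℝ} {K : Finset ℤ} (hf : ∀ j ∉ K, f j = 0) (k : ℤ) :
    ∑ j ∈ K, birthDeathRate lam mu k j * f j = birthDeathOperator lam mu f k := by
  have hsingle (m : ℤ) : ∑ j ∈ K, (Pi.single j 1 : ℤ → ℝ) m * f j = f m := by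
    simp only [Pi.single_apply, ite_mul, one_mul, zero_mul, Finset.sum_ite_eq]
    exact ite_eq_left_iff.2 fun hm => (hf m hm).symm
  simp only [birthDeathRate, birthDeathOperator]
  rw [← hsingle (k + 1), ← hsingle (k - 1), ← hsingle k, Finset.mul_sum, Finset.mul_sum,
    Finset.mul_sum, ← Finset.sum_add_distrib, ← Finset.sum_sub_distrib]
  exact Finset.sum_congr rfl fun j _ => by ring

theorem birthDeathRate_doobTransform {nu : ℤ → ℝ} (hnu_ne : ∀ n, nu n ≠ 0)
    (hnu : ∀ n, nu (n + 1) * lam n - nu n * (lam n + mu n) + nu (n - 1) * mu n = 0) (i j : ℤ) :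
    birthDeathRate (fun n => lam n * (nu (n + 1) / nu n)) (fun n => mu n * (nu (n - 1) / nu n)) i j
      = nu j / nu i * birthDeathRate lam mu i j := by
  have hsingle (m : ℤ) : nu m * (Pi.single j 1 : ℤ → ℝ) m = nu j * (Pi.single j 1 : ℤ → ℝ) m := by
    rcases eq_or_ne m j with rfl | hm
    · rfl
    · simp [hm]
  have hrates : lam i * (nu (i + 1) / nu i) + mu i * (nu (i - 1) / nu i) = lam i + mu i := by
    field_simp [hnu_ne i]
    linear_combination hnu i
  simp only [birthDeathRate, birthDeathOperator, hrates]
  field_simp [hnu_ne i]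
  linear_combination lam i * hsingle (i + 1) + mu i * hsingle (i - 1) - (lam i + mu i) * hsingle i

theorem hasDerivAt_absorptionProbability_birthDeathRate {s k : ℤ} {K : Finset ℤ} (hks : k ≠ s)
    (hk : k ∈ K) (hs : s ∈ K) (t : ℝ) :
    HasDerivAt (absorptionProbability (birthDeathRate lam mu) s K k)
      (birthDeathOperator lam mu
        (fun j => absorptionProbability (birthDeathRate lam mu) s K j t) k) t := by
  rw [← sum_birthDeathRate_mul fun j hj => absorptionProbability_of_notMem hj t]
  simpa only [if_neg hks] using
    hasDerivAt_absorptionProbability (Q := birthDeathRate lam mu) hk hs t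

end BirthDeathRate

section Skeleton

theorem measurable_stoppedAtExit {Ω β : Type*} {m : MeasurableSpace Ω} {mβ : MeasurableSpace β}
    {D : Set β} (hD : MeasurableSet D) {z : ℕ → Ω → β} {n : ℕ}
    (hz : ∀ l ≤ n, Measurable (z l)) : Measurable fun ω => stoppedAtExit (z · ω) D n := by
  classical
  induction n with
  | zero => exact hz 0 le_rfl
  | succ n ih =>
    have hn := ih fun l hl => hz l (hl.trans n.le_succ)
    exact Measurable.ite (hn hD) (hz (n + 1) le_rfl) hn

variable {Ω : Type*}

/-- The past `σ(X r, r ≤ t)` of the process `X` at time `t`. -/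
abbrev past (X : ℝ≥0 → Ω → Option ℤ) (t : ℝ≥0) : MeasurableSpace Ω :=
  ⨆ r : Iic t, (⊤ : MeasurableSpace (Option ℤ)).comap (X r)

/-- The states in which the process absorbed at `s` and killed outside `K` keeps moving. -/
def transientStates (s : ℤ) (K : Finset ℤ) : Set (Option ℤ) :=
  some '' (K.erase s : Set ℤ)

/-- The process `X` sampled at the multiples of `δ` and frozen once it is at `s` or outside `K`. -/
noncomputable def absorbedSkeleton (X : ℝ≥0 → Ω → Option ℤ) (s : ℤ) (K : Finset ℤ) (δ : ℝ≥0)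
    (N : ℕ) (ω : Ω) : Option ℤ :=
  stoppedAtExit (fun l : ℕ => X (l * δ) ω) (transientStates s K) N

variable {X : ℝ≥0 → Ω → Option ℤ} {s : ℤ} {K : Finset ℤ} {δ : ℝ≥0}

theorem some_mem_transientStates {i : ℤ} : some i ∈ transientStates s K ↔ i ≠ s ∧ i ∈ K := by
  rw [transientStates, (Option.some_injective ℤ).mem_set_image, Finset.mem_coe, Finset.mem_erase]

theorem some_target_notMem_transientStates : some s ∉ transientStates s K :=
  fun h => (some_mem_transientStates.1 h).1 rfl

theorem measurable_past {r t : ℝ≥0} (hr : r ≤ t) : Measurable[past X t, ⊤] (X r) :=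
  Measurable.of_comap_le (le_iSup (fun r : Iic t => (⊤ : MeasurableSpace (Option ℤ)).comap (X r))
    ⟨r, hr⟩)

theorem measurableSet_past_absorbedSkeleton (N : ℕ) (x : Option ℤ) :
    MeasurableSet[past X (N * δ)] {ω | absorbedSkeleton X s K δ N ω = x} :=
  measurable_stoppedAtExit (mβ := ⊤) (D := transientStates s K) (z := fun l ω => X (l * δ) ω)
    trivial (fun l hl => measurable_past (by gcongr)) (t := {x}) trivial

variable [MeasurableSpace Ω] {P : ℤ → Measure Ω} {lam mu : ℤ → ℝ}

/-- The one-step transition matrix of `absorbedSkeleton`, restricted to `K`. -/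
noncomputable def skeletonMatrix (P : ℤ → Measure Ω) (X : ℝ≥0 → Ω → Option ℤ) (s : ℤ)
    (K : Finset ℤ) (δ : ℝ≥0) : Matrix K K ℝ :=
  Matrix.of fun i j => if i = s then (1 : Matrix K K ℝ) i j else (P i).real {ω | X δ ω = some ↑j}

namespace IsBilateralBirthDeath

theorem past_le (hX : IsBilateralBirthDeath lam mu P X) (t : ℝ≥0) :
    past X t ≤ ‹MeasurableSpace Ω› := by
  refine iSup_le fun r => Measurable.comap_le ?_
  let _ : MeasurableSpace (Option ℤ) := ⊤
  refine measurable_to_countable' fun x => ?_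
  rcases x with _ | n
  · have hnone : X r ⁻¹' {none} = (⋃ n : ℤ, {ω | X r ω = some n})ᶜ := by
      ext ω
      rcases h : X r ω with _ | m <;> simp [h]
    rw [hnone]
    exact (MeasurableSet.iUnion (hX.measurableSet_eq r)).compl
  · exact hX.measurableSet_eq r n

theorem measurableSet_absorbedSkeleton (hX : IsBilateralBirthDeath lam mu P X) (N : ℕ)
    (x : Option ℤ) : MeasurableSet {ω | absorbedSkeleton X s K δ N ω = x} :=
  hX.past_le _ _ (measurableSet_past_absorbedSkeleton N x)

theorem real_initial (hX : IsBilateralBirthDeath lam mu P X) (k j : ℤ) :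
    (P k).real {ω | X 0 ω = some j} = if k = j then 1 else 0 := by
  have := hX.isProbabilityMeasure k
  split_ifs with h
  · subst h
    rw [measureReal_def, prob_compl_eq_zero_iff (hX.measurableSet_eq 0 k) |>.1 (hX.initial k),
      ENNReal.toReal_one]
  · rw [measureReal_eq_zero_iff, measure_eq_zero_iff_ae_notMem]
    filter_upwards [hX.initial k] with ω hω hj
    exact h (Option.some_injective _ (hω.symm.trans hj))

theorem real_absorbedSkeleton_inter_succ (hX : IsBilateralBirthDeath lam mu P X) (k : ℤ) (N : ℕ)
    (i j : K) :
    (P k).real ({ω | absorbedSkeleton X s K δ N ω = some ↑i} ∩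
      {ω | absorbedSkeleton X s K δ (N + 1) ω = some ↑j}) =
      (P k).real {ω | absorbedSkeleton X s K δ N ω = some ↑i} * skeletonMatrix P X s K δ i j := by
  set A := {ω | absorbedSkeleton X s K δ N ω = some ↑i}
  by_cases his : (i : ℤ) = s
  · have hfrozen : A ⊆ {ω | absorbedSkeleton X s K δ (N + 1) ω = some ↑i} := by
      intro ω (hω : absorbedSkeleton X s K δ N ω = some ↑i)
      have hleft : absorbedSkeleton X s K δ N ω ∉ transientStates s K := by
        rw [hω, his]
        exact some_target_notMem_transientStates
      exact (if_neg hleft).trans hω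
    rw [skeletonMatrix, Matrix.of_apply, if_pos his]
    rcases eq_or_ne i j with rfl | hij
    · rw [Matrix.one_apply_eq, mul_one, inter_eq_left.2 hfrozen]
    · rw [Matrix.one_apply_ne hij, mul_zero, disjoint_iff_inter_eq_empty.1, measureReal_empty]
      exact Set.disjoint_left.2 fun ω hi hj => hij (Subtype.ext (Option.some_injective _
        ((hfrozen hi).symm.trans hj)))
  · have hmem : ∀ ω ∈ A, absorbedSkeleton X s K δ N ω ∈ transientStates s K := fun ω hω =>
      hω.symm ▸ some_mem_transientStates.2 ⟨his, i.2⟩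
    have hNi : A ∩ {ω | X (N * δ) ω = some ↑i} = A :=
      inter_eq_left.2 fun ω hω => (stoppedAtExit_eq_of_mem (hmem ω hω)).symm.trans hω
    have hNj : A ∩ {ω | absorbedSkeleton X s K δ (N + 1) ω = some ↑j} =
        A ∩ {ω | X (N * δ + δ) ω = some ↑j} := by
      ext ω
      refine and_congr_right fun hω => ?_
      have hstep : absorbedSkeleton X s K δ (N + 1) ω = X (N * δ + δ) ω := by
        rw [← add_one_mul, ← Nat.cast_succ]
        exact if_pos (hmem ω hω)
      simp only [mem_ofPred_eq, hstep]
    have hmarkov := hX.markov k (N * δ) δ i j A (measurableSet_past_absorbedSkeleton N _)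
    rw [hNi] at hmarkov
    rw [hNj, skeletonMatrix, Matrix.of_apply, if_neg his, measureReal_def, hmarkov,
      ENNReal.toReal_mul, measureReal_def, measureReal_def]

theorem real_absorbedSkeleton (hX : IsBilateralBirthDeath lam mu P X) (k : K) (N : ℕ) (j : K) :
    (P k).real {ω | absorbedSkeleton X s K δ N ω = some ↑j} =
      (skeletonMatrix P X s K δ ^ N) k j := by
  have := hX.isProbabilityMeasure k
  induction N generalizing j with
  | zero =>
    simpa only [absorbedSkeleton, stoppedAtExit, Nat.cast_zero, zero_mul, pow_zero,
      Matrix.one_apply, Subtype.ext_iff] using hX.real_initial k j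
  | succ N ih =>
    have hprev (ω : Ω) (hω : absorbedSkeleton X s K δ (N + 1) ω = some ↑j) :
        ∃ i : K, absorbedSkeleton X s K δ N ω = some ↑i := by
      by_cases h : absorbedSkeleton X s K δ N ω ∈ transientStates s K
      · obtain ⟨i, hi, hiω⟩ := h
        exact ⟨⟨i, Finset.mem_of_mem_erase hi⟩, hiω.symm⟩
      · exact ⟨j, (if_neg h).symm.trans hω⟩
    have hunion : {ω | absorbedSkeleton X s K δ (N + 1) ω = some ↑j} =
        ⋃ i : K, {ω | absorbedSkeleton X s K δ N ω = some ↑i} ∩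
          {ω | absorbedSkeleton X s K δ (N + 1) ω = some ↑j} := by
      rw [← iUnion_inter]
      exact (inter_eq_right.2 fun ω hω => mem_iUnion.2 (hprev ω hω)).symm
    rw [hunion, measureReal_iUnion_fintype, pow_succ, Matrix.mul_apply]
    · simp only [hX.real_absorbedSkeleton_inter_succ, ih]
    · exact fun i i' hii' => Set.disjoint_left.2 fun ω h h' =>
        hii' (Subtype.ext (Option.some_injective _ (h.1.symm.trans h'.1)))
    · exact fun i => (hX.measurableSet_absorbedSkeleton N _).inter
        (hX.measurableSet_absorbedSkeleton (N + 1) _)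

theorem tendsto_offDiagonal_rate (hX : IsBilateralBirthDeath lam mu P X) {k j : ℤ}
    (hbirth : k + 1 ≠ j) (hdeath : k - 1 ≠ j) (hstay : k ≠ j) :
    Tendsto (fun δ : ℝ≥0 => (P k).real {ω | X δ ω = some j} / (δ : ℝ)) (𝓝[>] 0) (𝓝 0) := by
  have := hX.isProbabilityMeasure k
  have hlim := ((hX.leave_rate k).sub (hX.birth_rate k)).sub (hX.death_rate k)
  rw [show lam k + mu k - lam k - mu k = 0 by ring] at hlim
  refine squeeze_zero (fun δ => by positivity) (fun δ => ?_) hlim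
  rw [← sub_div, ← sub_div]
  gcongr
  have hdisj : (({k, k + 1, k - 1, j} : Finset ℤ) : Set ℤ).PairwiseDisjoint
      fun n => {ω | X δ ω = some n} := fun i _ i' _ hii' =>
    Set.disjoint_left.2 fun ω h h' => hii' (Option.some_injective _ (h.symm.trans h'))
  have hle := measureReal_le_one (μ := P k)
    (s := ⋃ n ∈ ({k, k + 1, k - 1, j} : Finset ℤ), {ω | X δ ω = some n})
  rw [measureReal_biUnion_finset hdisj fun n _ => hX.measurableSet_eq δ n,
    Finset.sum_insert (by simp; omega), Finset.sum_insert (by simp; omega),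
    Finset.sum_insert (by simpa using hdeath), Finset.sum_singleton] at hle
  linarith

theorem tendsto_transition_rate (hX : IsBilateralBirthDeath lam mu P X) (i j : ℤ) :
    Tendsto (fun δ : ℝ≥0 => ((P i).real {ω | X δ ω = some j} - if i = j then 1 else 0) / (δ : ℝ))
      (𝓝[>] 0) (𝓝 (birthDeathRate lam mu i j)) := by
  simp only [birthDeathRate, birthDeathOperator, Pi.single_apply]
  by_cases hstay : i = j
  · subst hstay
    simpa [← neg_div] using (hX.leave_rate i).neg
  by_cases hbirth : i + 1 = j
  · subst hbirth
    simpa [show i - 1 ≠ i + 1 by lia] using hX.birth_rate i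
  by_cases hdeath : i - 1 = j
  · subst hdeath
    simpa [show i + 1 ≠ i - 1 by lia, show i ≠ i - 1 by lia] using hX.death_rate i
  simpa [hstay, hbirth, hdeath] using hX.tendsto_offDiagonal_rate hbirth hdeath hstay

theorem tendsto_skeletonMatrix (hX : IsBilateralBirthDeath lam mu P X) :
    Tendsto (fun δ : ℝ≥0 => (δ : ℝ)⁻¹ • (skeletonMatrix P X s K δ - 1)) (𝓝[>] 0)
      (𝓝 (killedGenerator (birthDeathRate lam mu) s K)) := by
  refine tendsto_pi_nhds.2 fun i => tendsto_pi_nhds.2 fun j => ?_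
  have hentry (δ : ℝ≥0) : ((δ : ℝ)⁻¹ • (skeletonMatrix P X s K δ - 1)) i j = if i = s then 0 else
      ((P i).real {ω | X δ ω = some ↑j} - if (i : ℤ) = j then 1 else 0) / (δ : ℝ) := by
    rw [Matrix.smul_apply, Matrix.sub_apply, skeletonMatrix, Matrix.of_apply, smul_eq_mul]
    split_ifs with his hij
    · rw [sub_self, mul_zero]
    · rw [Matrix.one_apply, if_pos (Subtype.ext hij), div_eq_inv_mul]
    · rw [Matrix.one_apply, if_neg (hij ∘ congrArg Subtype.val), div_eq_inv_mul]
  simp only [hentry, killedGenerator, Matrix.of_apply]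
  by_cases his : (i : ℤ) = s
  · simp only [if_pos his, tendsto_const_nhds]
  · simp only [if_neg his]
    exact hX.tendsto_transition_rate i j

end IsBilateralBirthDeath

end Skeleton

section FirstPassageLimit

theorem tendsto_measureReal_of_ae_eventually_mem_iff {Ω ι : Type*} [MeasurableSpace Ω]
    {μ : Measure Ω} [IsFiniteMeasure μ] {l : Filter ι} [l.NeBot] [l.IsCountablyGenerated]
    {A : ι → Set Ω} {B : Set Ω} (hA : ∀ i, MeasurableSet (A i))
    (h : ∀ᵐ ω ∂μ, ∀ᶠ i in l, ω ∈ A i ↔ ω ∈ B) :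
    Tendsto (fun i => μ.real (A i)) l (𝓝 (μ.real B)) := by
  have hB : NullMeasurableSet B μ :=
    nullMeasurableSet_of_tendsto_indicator l (fun i => (hA i).nullMeasurableSet) h
  refine (ENNReal.tendsto_toReal (measure_ne_top _ _)).comp ?_
  rw [← measure_toMeasurable]
  refine tendsto_measure_of_ae_tendsto_indicator_of_isFiniteMeasure l
    (measurableSet_toMeasurable _ _) hA ?_
  filter_upwards [h, hB.toMeasurable_ae_eq.mem_iff] with ω hω hB
  simpa only [hB] using hω

theorem exists_finset_reachesThrough {x : ℝ≥0 → Option ℤ}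
    (hright : ∀ u, ∀ᶠ v in 𝓝[>] u, x v = x u)
    (hleft : ∀ u (n : ℤ), x u = some n → ∃ m : ℤ, ∀ᶠ v in 𝓝[<] u, x v = some m)
    (habs : ∀ u v, u ≤ v → x u = none → x v = none) {s : ℤ} {u : ℝ≥0} (hu : x u = some s) :
    ∃ T ≤ u, ∃ K, ReachesThrough x (transientStates s K) (some s) T := by
  obtain ⟨T, hTu, hTs, -, hT⟩ :=
    exists_reachesThrough_of_notMem (D := {some s}ᶜ) hright (not_not.2 hu)
  replace hTs : x T = some s := not_not.1 hTs
  have halive (v : ℝ≥0) (hv : v ≤ T) : ∃ n, x v = some n :=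
    Option.ne_none_iff_exists'.1 fun h => by simp [habs v T hv h] at hTs
  have hfin : (x '' Icc 0 T).Finite := by
    refine finite_image_of_eventually_eq_nhdsLT_nhdsGT isCompact_Icc (fun v hv => ?_)
      fun v _ => ⟨x v, hright v⟩
    obtain ⟨n, hn⟩ := halive v hv.2
    obtain ⟨m, hm⟩ := hleft v n hn
    exact ⟨some m, hm⟩
  refine ⟨T, hTu, (hfin.preimage (Option.some_injective ℤ).injOn).toFinset, hTs, fun v hv => ?_⟩
  obtain ⟨n, hn⟩ := halive v hv.le
  rw [hn, some_mem_transientStates, Finite.mem_toFinset]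
  exact ⟨fun hns => hT v hv (hns ▸ hn), v, ⟨zero_le, hv.le⟩, hn⟩

variable {Ω : Type*}

/-- The event that `X` reaches `s` before time `t`, staying in `K` until then. -/
def absorptionEvent (X : ℝ≥0 → Ω → Option ℤ) (s : ℤ) (K : Finset ℤ) (t : ℝ≥0) : Set Ω :=
  {ω | ∃ u < t, ReachesThrough (X · ω) (transientStates s K) (some s) u}

theorem monotone_absorptionEvent (X : ℝ≥0 → Ω → Option ℤ) (s : ℤ) (t : ℝ≥0) :
    Monotone fun K => absorptionEvent X s K t := by
  rintro K L hKL ω ⟨u, hut, hu⟩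
  exact ⟨u, hut, hu.mono (image_mono (Finset.coe_subset.2 (Finset.erase_subset_erase s hKL)))⟩

variable [MeasurableSpace Ω] {P : ℤ → Measure Ω} {X : ℝ≥0 → Ω → Option ℤ} {lam mu : ℤ → ℝ}
  {k s : ℤ} {K : Finset ℤ}

namespace IsBilateralBirthDeath

theorem ae_eventually_eq_nhdsGT (hX : IsBilateralBirthDeath lam mu P X) (k : ℤ) :
    ∀ᵐ ω ∂P k, ∀ u, ∀ᶠ v in 𝓝[>] u, X v ω = X u ω := by
  filter_upwards [hX.right_continuous k, hX.absorbing k] with ω hright habs u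
  rcases hu : X u ω with _ | n
  · filter_upwards [self_mem_nhdsWithin] with v hv
    exact habs u v (mem_Ioi.1 hv).le hu
  · exact hright u n hu

open scoped Matrix.Norms.Operator in
theorem real_absorptionEvent (hX : IsBilateralBirthDeath lam mu P X) (hk : k ∈ K) (hs : s ∈ K)
    {t : ℝ≥0} (ht : 0 < t) :
    (P k).real (absorptionEvent X s K t) =
      absorptionProbability (birthDeathRate lam mu) s K k t := by
  have := hX.isProbabilityMeasure k
  have : Nonempty K := ⟨⟨k, hk⟩⟩
  set M : ℕ → Matrix K K ℝ := fun N => skeletonMatrix P X s K (t / (N + 1)) with hM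
  have hskeleton : Tendsto (fun N => (M N ^ N) ⟨k, hk⟩ ⟨s, hs⟩) atTop
      (𝓝 ((P k).real (absorptionEvent X s K t))) := by
    simp only [hM, ← hX.real_absorbedSkeleton]
    refine tendsto_measureReal_of_ae_eventually_mem_iff
      (fun N => hX.measurableSet_absorbedSkeleton N _) ?_
    filter_upwards [hX.ae_eventually_eq_nhdsGT k] with ω hω
    filter_upwards [eventually_sampled_reachesThrough_iff hω
      (some_target_notMem_transientStates (K := K)) ht] with N hN
    exact (stoppedAtExit_eq_iff some_target_notMem_transientStates).trans hN
  have hslope : Tendsto (fun N : ℕ => (N : ℝ) • (M N - 1)) atTop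
      (𝓝 ((t : ℝ) • killedGenerator (birthDeathRate lam mu) s K)) := by
    have hratio := (tendsto_natCast_div_add_atTop (1 : ℝ)).const_mul (t : ℝ)
    rw [mul_one] at hratio
    refine (hratio.smul (hX.tendsto_skeletonMatrix.comp
      (tendsto_div_natCast_add_one_nhdsGT ht))).congr fun N => ?_
    rw [Function.comp_apply, smul_smul]
    congr 1
    push_cast
    field_simp
  have hexp := tendsto_pow_exp_of_tendsto_smul_sub_one hslope
  rw [absorptionProbability_of_mem hk hs]
  exact tendsto_nhds_unique hskeleton
    (tendsto_pi_nhds.1 (tendsto_pi_nhds.1 hexp ⟨k, hk⟩) ⟨s, hs⟩)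

theorem absorptionProbability_mem_Icc (hX : IsBilateralBirthDeath lam mu P X) {t : ℝ}
    (ht : 0 < t) : absorptionProbability (birthDeathRate lam mu) s K k t ∈ Icc 0 1 := by
  have := hX.isProbabilityMeasure k
  by_cases h : k ∈ K ∧ s ∈ K
  · lift t to ℝ≥0 using ht.le
    rw [← hX.real_absorptionEvent h.1 h.2 (NNReal.coe_pos.1 ht)]
    exact ⟨measureReal_nonneg, measureReal_le_one⟩
  · rw [absorptionProbability, dif_neg h]
    exact ⟨le_rfl, zero_le_one⟩

theorem firstPassageCDF_eq_iUnion (hX : IsBilateralBirthDeath lam mu P X) (hks : k ≠ s)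
    (t : ℝ≥0) :
    firstPassageCDF P X k s t = (P k).real (⋃ K, absorptionEvent X s K t) := by
  refine measureReal_congr ?_
  filter_upwards [hX.initial k, hX.ae_eventually_eq_nhdsGT k, hX.left_limit k, hX.absorbing k]
    with ω hstart hright hleft habs
  refine propext ((?_ : firstPassageTime X s ω < ENNReal.ofReal t ↔ _).trans mem_iUnion.symm)
  simp only [firstPassageTime, iInf_lt_iff, ENNReal.ofReal_coe_nnreal, ENNReal.coe_lt_coe]
  constructor
  · rintro ⟨u, ⟨-, hu⟩, hut⟩
    obtain ⟨T, hTu, K, hT⟩ := exists_finset_reachesThrough hright hleft habs hu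
    exact ⟨K, T, hTu.trans_lt hut, hT⟩
  · rintro ⟨K, u, hut, hu, -⟩
    refine ⟨u, ⟨pos_iff_ne_zero.2 ?_, hu⟩, hut⟩
    rintro rfl
    exact hks (Option.some_injective _ (hstart.symm.trans hu))

theorem tendsto_absorptionProbability (hX : IsBilateralBirthDeath lam mu P X) (hks : k ≠ s)
    {t : ℝ} (ht : 0 < t) :
    Tendsto (fun K => absorptionProbability (birthDeathRate lam mu) s K k t) atTop
      (𝓝 (firstPassageCDF P X k s t)) := by
  have := hX.isProbabilityMeasure k
  lift t to ℝ≥0 using ht.le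
  rw [hX.firstPassageCDF_eq_iUnion hks]
  refine ((ENNReal.tendsto_toReal (measure_ne_top _ _)).comp
    (tendsto_measure_iUnion_atTop (monotone_absorptionEvent X s t))).congr' ?_
  filter_upwards [eventually_ge_atTop {k, s}] with K hK
  exact hX.real_absorptionEvent (hK (by simp)) (hK (by simp)) (NNReal.coe_pos.1 ht)

end IsBilateralBirthDeath

end FirstPassageLimit

section BackwardEquation

variable {lam mu : ℤ → ℝ} {k s : ℤ} {K : Finset ℤ}

theorem tendsto_birthDeathOperator {ι : Type*} {l : Filter ι} {F : ι → ℤ → ℝ} {f : ℤ → ℝ}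
    (hF : ∀ j, Tendsto (F · j) l (𝓝 (f j))) (k : ℤ) :
    Tendsto (fun i => birthDeathOperator lam mu (F i) k) l
      (𝓝 (birthDeathOperator lam mu f k)) :=
  (((hF (k + 1)).const_mul _).add ((hF (k - 1)).const_mul _)).sub ((hF k).const_mul _)

theorem continuous_birthDeathOperator {F : ℝ → ℤ → ℝ} (hF : ∀ j, Continuous (F · j)) (k : ℤ) :
    Continuous fun t => birthDeathOperator lam mu (F t) k :=
  continuous_iff_continuousAt.2 fun _ =>
    tendsto_birthDeathOperator (fun j => (hF j).continuousAt) k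

theorem abs_birthDeathOperator_le {f : ℤ → ℝ} (hf : ∀ j, f j ∈ Icc 0 1) (hlam : 0 ≤ lam k)
    (hmu : 0 ≤ mu k) : |birthDeathOperator lam mu f k| ≤ lam k + mu k := by
  have hle {c : ℝ} (hc : 0 ≤ c) (j : ℤ) : c * f j ∈ Icc 0 c :=
    ⟨mul_nonneg hc (hf j).1, mul_le_of_le_one_right hc (hf j).2⟩
  have hup := hle hlam (k + 1)
  have hdown := hle hmu (k - 1)
  have hstay := hle (add_nonneg hlam hmu) k
  rw [birthDeathOperator, abs_sub_le_iff]
  constructor <;> linarith [hup.1, hup.2, hdown.1, hdown.2, hstay.1, hstay.2]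

theorem absorptionProbability_eq_integral (hks : k ≠ s) (hk : k ∈ K) (hs : s ∈ K) (t : ℝ) :
    absorptionProbability (birthDeathRate lam mu) s K k t =
      ∫ v in (0 : ℝ)..t, birthDeathOperator lam mu
        (fun j => absorptionProbability (birthDeathRate lam mu) s K j v) k := by
  rw [intervalIntegral.integral_eq_sub_of_hasDerivAt
    (fun v _ => hasDerivAt_absorptionProbability_birthDeathRate hks hk hs v)
    ((continuous_birthDeathOperator (fun _ => continuous_absorptionProbability) k)
      |>.intervalIntegrable _ _), absorptionProbability_zero hks, sub_zero]

variable {Ω : Type*} [MeasurableSpace Ω] {P : ℤ → Measure Ω} {X : ℝ≥0 → Ω → Option ℤ}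

theorem firstPassageCDF_of_nonpos {t : ℝ} (ht : t ≤ 0) : firstPassageCDF P X k s t = 0 := by
  simp [firstPassageCDF, ENNReal.ofReal_of_nonpos ht]

/-- The probability that `X` started at `k` visits `s` before time `t`. It differs from
`firstPassageCDF`, which counts positive times only, in being `1` for `k = s`; this is the boundary
condition of the backward equation. -/
noncomputable def hittingProbability (P : ℤ → Measure Ω) (X : ℝ≥0 → Ω → Option ℤ) (s k : ℤ)
    (t : ℝ) : ℝ :=
  if k = s then 1 else firstPassageCDF P X k s t

theorem hittingProbability_self : hittingProbability P X s s = fun _ => 1 :=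
  funext fun _ => if_pos rfl

theorem hittingProbability_of_ne (hks : k ≠ s) :
    hittingProbability P X s k = firstPassageCDF P X k s :=
  funext fun _ => if_neg hks

theorem hittingProbability_nonneg (s k : ℤ) (t : ℝ) : 0 ≤ hittingProbability P X s k t := by
  rw [hittingProbability]
  split_ifs
  · exact zero_le_one
  · exact measureReal_nonneg

namespace IsBilateralBirthDeath

theorem monotone_firstPassageCDF (hX : IsBilateralBirthDeath lam mu P X) (k s : ℤ) :
    Monotone (firstPassageCDF P X k s) := by
  have := hX.isProbabilityMeasure k
  intro t u htu
  exact measureReal_mono fun ω hω => lt_of_lt_of_le hω (ENNReal.ofReal_le_ofReal htu)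

theorem monotone_hittingProbability (hX : IsBilateralBirthDeath lam mu P X) (s k : ℤ) :
    Monotone (hittingProbability P X s k) := by
  rcases eq_or_ne k s with rfl | hks
  · rw [hittingProbability_self]
    exact monotone_const
  · rw [hittingProbability_of_ne hks]
    exact hX.monotone_firstPassageCDF k s

theorem tendsto_absorptionProbability_hittingProbability (hX : IsBilateralBirthDeath lam mu P X)
    (s k : ℤ) {t : ℝ} (ht : 0 < t) :
    Tendsto (fun K => absorptionProbability (birthDeathRate lam mu) s K k t) atTop
      (𝓝 (hittingProbability P X s k t)) := by
  rcases eq_or_ne k s with rfl | hks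
  · rw [hittingProbability_self]
    refine tendsto_const_nhds.congr' ?_
    filter_upwards [eventually_ge_atTop {k}] with K hK
    exact (absorptionProbability_self (Finset.singleton_subset_iff.1 hK) t).symm
  · rw [hittingProbability_of_ne hks]
    exact hX.tendsto_absorptionProbability hks ht

theorem firstPassageCDF_eq_integral (hX : IsBilateralBirthDeath lam mu P X) (hks : k ≠ s) {t : ℝ}
    (ht : 0 ≤ t) :
    firstPassageCDF P X k s t =
      ∫ v in (0 : ℝ)..t, birthDeathOperator lam mu (hittingProbability P X s · v) k := by
  rcases ht.eq_or_lt with rfl | ht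
  · rw [firstPassageCDF_of_nonpos le_rfl, intervalIntegral.integral_same]
  have hintegral : Tendsto (fun K => ∫ v in (0 : ℝ)..t, birthDeathOperator lam mu
      (fun j => absorptionProbability (birthDeathRate lam mu) s K j v) k) atTop
      (𝓝 (∫ v in (0 : ℝ)..t, birthDeathOperator lam mu (hittingProbability P X s · v) k)) := by
    refine intervalIntegral.tendsto_integral_filter_of_dominated_convergence
      (fun _ => lam k + mu k) (Eventually.of_forall fun K => ?_)
      (Eventually.of_forall fun K => ae_of_all _ fun v hv => ?_) intervalIntegrable_const
      (ae_of_all _ fun v hv => ?_)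
    · exact (continuous_birthDeathOperator (fun _ => continuous_absorptionProbability)
        k).aestronglyMeasurable
    · rw [uIoc_of_le ht.le] at hv
      exact abs_birthDeathOperator_le (fun _ => hX.absorptionProbability_mem_Icc hv.1)
        (hX.birth_pos k).le (hX.death_pos k).le
    · rw [uIoc_of_le ht.le] at hv
      exact tendsto_birthDeathOperator
        (fun j => hX.tendsto_absorptionProbability_hittingProbability s j hv.1) k
  refine tendsto_nhds_unique (hX.tendsto_absorptionProbability hks ht) (hintegral.congr' ?_)
  filter_upwards [eventually_ge_atTop {k, s}] with K hK
  exact (absorptionProbability_eq_integral hks (hK (by simp)) (hK (by simp)) t).symm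

theorem intervalIntegrable_birthDeathOperator_hittingProbability
    (hX : IsBilateralBirthDeath lam mu P X) (s k : ℤ) (a b : ℝ) :
    IntervalIntegrable (fun v => birthDeathOperator lam mu (hittingProbability P X s · v) k)
      volume a b := by
  have hintegral (c : ℝ) (j : ℤ) :
      IntervalIntegrable (fun v => c * hittingProbability P X s j v) volume a b :=
    (hX.monotone_hittingProbability s j).intervalIntegrable.const_mul c
  exact ((hintegral _ _).add (hintegral _ _)).sub (hintegral _ _)

theorem continuousOn_firstPassageCDF (hX : IsBilateralBirthDeath lam mu P X) (hks : k ≠ s) :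
    ContinuousOn (firstPassageCDF P X k s) (Ici 0) :=
  (intervalIntegral.continuous_primitive
    (hX.intervalIntegrable_birthDeathOperator_hittingProbability s k) 0).continuousOn.congr
    fun _ ht => hX.firstPassageCDF_eq_integral hks ht

theorem continuousAt_hittingProbability (hX : IsBilateralBirthDeath lam mu P X) (s k : ℤ) {t : ℝ}
    (ht : 0 < t) : ContinuousAt (hittingProbability P X s k) t := by
  rcases eq_or_ne k s with rfl | hks
  · rw [hittingProbability_self]
    exact continuousAt_const
  · rw [hittingProbability_of_ne hks]
    exact (hX.continuousOn_firstPassageCDF hks).continuousAt (Ici_mem_nhds ht)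

theorem hasDerivAt_firstPassageCDF (hX : IsBilateralBirthDeath lam mu P X) (hks : k ≠ s) {t : ℝ}
    (ht : 0 < t) :
    HasDerivAt (firstPassageCDF P X k s)
      (birthDeathOperator lam mu (hittingProbability P X s · t) k) t := by
  have hmeas : Measurable fun v => birthDeathOperator lam mu (hittingProbability P X s · v) k := by
    have hj (j : ℤ) := (hX.monotone_hittingProbability s j).measurable
    unfold birthDeathOperator
    fun_prop
  refine (intervalIntegral.integral_hasDerivAt_right
    (hX.intervalIntegrable_birthDeathOperator_hittingProbability s k 0 t)
    hmeas.stronglyMeasurable.stronglyMeasurableAtFilter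
    (tendsto_birthDeathOperator (fun j => hX.continuousAt_hittingProbability s j ht)
      k)).congr_of_eventuallyEq ?_
  filter_upwards [Ici_mem_nhds ht] with u hu
  exact hX.firstPassageCDF_eq_integral hks hu

end IsBilateralBirthDeath

end BackwardEquation

section CrossingProbability

variable {lam mu nu : ℤ → ℝ} {k s : ℤ} {Ω : Type*} [MeasurableSpace Ω] {P : ℤ → Measure Ω}
  {X : ℝ≥0 → Ω → Option ℤ}

namespace IsBilateralBirthDeath

theorem hasDerivAt_firstPassageDensity (hX : IsBilateralBirthDeath lam mu P X) (hks : k ≠ s)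
    {t : ℝ} (ht : 0 < t) :
    HasDerivAt (firstPassageCDF P X k s) (firstPassageDensity P X k s t) t :=
  (hX.hasDerivAt_firstPassageCDF hks ht).differentiableAt.hasDerivAt

theorem firstPassageDensity_nonneg (hX : IsBilateralBirthDeath lam mu P X) (k s : ℤ) (t : ℝ) :
    0 ≤ firstPassageDensity P X k s t :=
  (hX.monotone_firstPassageCDF k s).deriv_nonneg

theorem tendsto_firstPassageCDF_atTop (hX : IsBilateralBirthDeath lam mu P X) (k s : ℤ) :
    Tendsto (firstPassageCDF P X k s) atTop (𝓝 (⨆ t, firstPassageCDF P X k s t)) := by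
  have := hX.isProbabilityMeasure k
  exact tendsto_atTop_ciSup (hX.monotone_firstPassageCDF k s)
    ⟨1, forall_mem_range.2 fun _ => measureReal_le_one⟩

theorem hasFirstPassageDensity (hX : IsBilateralBirthDeath lam mu P X) (hks : k ≠ s) :
    HasFirstPassageDensity P X k s := by
  have hintegral : IntegrableOn (firstPassageDensity P X k s) (Ioi 0) :=
    integrableOn_Ioi_deriv_of_nonneg (hX.continuousOn_firstPassageCDF hks 0 self_mem_Ici)
      (fun t ht => hX.hasDerivAt_firstPassageDensity hks ht)
      (fun t _ => hX.firstPassageDensity_nonneg k s t) (hX.tendsto_firstPassageCDF_atTop k s)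
  refine ⟨fun t ht => (hX.hasDerivAt_firstPassageCDF hks ht).differentiableAt, hintegral,
    fun t ht => ?_⟩
  rw [intervalIntegral.integral_eq_sub_of_hasDerivAt_of_le ht
    ((hX.continuousOn_firstPassageCDF hks).mono Icc_subset_Ici_self)
    (fun u hu => hX.hasDerivAt_firstPassageDensity hks hu.1)
    ((intervalIntegrable_iff_integrableOn_Ioc_of_le ht).2 (hintegral.mono_set Ioc_subset_Ioi_self)),
    firstPassageCDF_of_nonpos le_rfl, sub_zero]

theorem crossingProbability_eq_iSup (hX : IsBilateralBirthDeath lam mu P X) (hks : k ≠ s) :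
    crossingProbability P X k s = ⨆ t, firstPassageCDF P X k s t := by
  rw [crossingProbability, integral_Ioi_of_hasDerivAt_of_nonneg
    (hX.continuousOn_firstPassageCDF hks 0 self_mem_Ici)
    (fun t ht => hX.hasDerivAt_firstPassageDensity hks ht)
    (fun t _ => hX.firstPassageDensity_nonneg k s t) (hX.tendsto_firstPassageCDF_atTop k s),
    firstPassageCDF_of_nonpos le_rfl, sub_zero]

theorem firstPassageCDF_pos_of_neighbour (hX : IsBilateralBirthDeath lam mu P X) (hks : k ≠ s)
    {t : ℝ} (ht : 0 < t)
    (h : 0 < hittingProbability P X s (k + 1) t ∨ 0 < hittingProbability P X s (k - 1) t) :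
    0 < firstPassageCDF P X k s t := by
  have hnonneg (u : ℝ) : 0 ≤ firstPassageCDF P X k s u := measureReal_nonneg
  refine (hnonneg t).lt_of_ne' fun hzero => ?_
  have hmin : IsLocalMin (firstPassageCDF P X k s) t :=
    Eventually.of_forall fun u => hzero.trans_le (hnonneg u)
  have hbackward : lam k * hittingProbability P X s (k + 1) t +
      mu k * hittingProbability P X s (k - 1) t = 0 := by
    simpa only [birthDeathOperator, hittingProbability_of_ne hks, hzero, mul_zero, sub_zero] using
      hmin.hasDerivAt_eq_zero (hX.hasDerivAt_firstPassageCDF hks ht)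
  have hup := hittingProbability_nonneg (P := P) (X := X) s (k + 1) t
  have hdown := hittingProbability_nonneg (P := P) (X := X) s (k - 1) t
  have hlam := hX.birth_pos k
  have hmu := hX.death_pos k
  refine hbackward.not_gt ?_
  rcases h with h | h <;> positivity

theorem hittingProbability_pos (hX : IsBilateralBirthDeath lam mu P X) (s k : ℤ) {t : ℝ}
    (ht : 0 < t) : 0 < hittingProbability P X s k t := by
  have hself : 0 < hittingProbability P X s s t := by
    rw [hittingProbability_self]
    exact one_pos
  rcases le_total s k with hk | hk
  · induction k, hk using Int.leInduction with
    | base => exact hself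
    | succ k hk ih =>
      have hne : k + 1 ≠ s := (Int.lt_add_one_of_le hk).ne'
      rw [hittingProbability_of_ne hne]
      exact hX.firstPassageCDF_pos_of_neighbour hne ht (Or.inr (by rwa [add_sub_cancel_right]))
  · induction k, hk using Int.leInductionDown with
    | base => exact hself
    | pred k hk ih =>
      have hne : k - 1 ≠ s := (Int.sub_one_lt_of_le hk).ne
      rw [hittingProbability_of_ne hne]
      exact hX.firstPassageCDF_pos_of_neighbour hne ht (Or.inl (by rwa [sub_add_cancel]))

theorem crossingProbability_pos (hX : IsBilateralBirthDeath lam mu P X) (hks : k ≠ s) :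
    0 < crossingProbability P X k s := by
  have hpos := hX.hittingProbability_pos s k one_pos
  rw [hittingProbability_of_ne hks] at hpos
  rw [hX.crossingProbability_eq_iSup hks]
  exact hpos.trans_le ((hX.monotone_firstPassageCDF k s).ge_of_tendsto
    (hX.tendsto_firstPassageCDF_atTop k s) 1)

theorem firstPassageCDF_doobTransform (hX : IsBilateralBirthDeath lam mu P X)
    {Ω' : Type*} [MeasurableSpace Ω'] {P' : ℤ → Measure Ω'} {X' : ℝ≥0 → Ω' → Option ℤ}
    (hnu_ne : ∀ n, nu n ≠ 0)
    (hnu : ∀ n, nu (n + 1) * lam n - nu n * (lam n + mu n) + nu (n - 1) * mu n = 0)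
    (hX' : IsBilateralBirthDeath (fun n => lam n * (nu (n + 1) / nu n))
      (fun n => mu n * (nu (n - 1) / nu n)) P' X') (hks : k ≠ s) (t : ℝ) :
    firstPassageCDF P' X' k s t = nu s / nu k * firstPassageCDF P X k s t := by
  rcases le_or_gt t 0 with ht | ht
  · rw [firstPassageCDF_of_nonpos ht, firstPassageCDF_of_nonpos ht, mul_zero]
  · refine tendsto_nhds_unique (hX'.tendsto_absorptionProbability hks ht)
      (((hX.tendsto_absorptionProbability hks ht).const_mul (nu s / nu k)).congr fun K => ?_)
    exact (absorptionProbability_doobTransform hnu_ne (birthDeathRate_doobTransform hnu_ne hnu)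
      t).symm

end IsBilateralBirthDeath

end CrossingProbability

theorem theorem2 (lam mu nu : ℤ → ℝ)
    {Ω : Type*} [MeasurableSpace Ω] (P : ℤ → Measure Ω) (X : ℝ≥0 → Ω → Option ℤ)
    {Ω' : Type*} [MeasurableSpace Ω'] (P' : ℤ → Measure Ω') (X' : ℝ≥0 → Ω' → Option ℤ)
    (hX : IsBilateralBirthDeath lam mu P X)
    (hnu_pos : ∀ n, 0 < nu n)
    (hnu_mono : StrictMono nu ∨ StrictAnti nu)
    (hnu : ∀ n, nu (n + 1) * lam n - nu n * (lam n + mu n) + nu (n - 1) * mu n = 0)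
    (hX' : IsBilateralBirthDeath (fun n => lam n * (nu (n + 1) / nu n))
      (fun n => mu n * (nu (n - 1) / nu n)) P' X') :
    ∀ k s : ℤ, k ≠ s →
      HasFirstPassageDensity P X k s ∧
      HasFirstPassageDensity P' X' k s ∧
      (∀ t : ℝ, 0 < t →
        firstPassageDensity P' X' k s t = nu s / nu k * firstPassageDensity P X k s t) ∧
      crossingProbability P' X' k s = nu s / nu k * crossingProbability P X k s ∧
      crossingProbability P' X' k s ≠ crossingProbability P X k s := by
  intro k s hks
  have hcdf : firstPassageCDF P' X' k s = fun t => nu s / nu k * firstPassageCDF P X k s t :=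
    funext fun t => hX.firstPassageCDF_doobTransform (fun n => (hnu_pos n).ne') hnu hX' hks t
  have hdens : ∀ t : ℝ, 0 < t →
      firstPassageDensity P' X' k s t = nu s / nu k * firstPassageDensity P X k s t := by
    intro t ht
    rw [firstPassageDensity, hcdf]
    exact ((hX.hasDerivAt_firstPassageDensity hks ht).const_mul _).deriv
  have hcross : crossingProbability P' X' k s = nu s / nu k * crossingProbability P X k s := by
    rw [crossingProbability, crossingProbability, ← integral_const_mul]
    exact setIntegral_congr_fun measurableSet_Ioi fun t ht => hdens t ht
  refine ⟨hX.hasFirstPassageDensity hks, hX'.hasFirstPassageDensity hks, hdens, hcross, ?_⟩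
  rw [hcross]
  intro h
  have hratio : nu s / nu k = 1 :=
    mul_right_cancel₀ (hX.crossingProbability_pos hks).ne' (h.trans (one_mul _).symm)
  have hinj : Function.Injective nu := hnu_mono.elim StrictMono.injective StrictAnti.injective
  exact hks (hinj ((div_eq_one_iff_eq (hnu_pos k).ne').1 hratio)).symm
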